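/- Let $\tau\in\mathbb C$ with $\operatorname{Im}\tau>0$, and let $$\theta(z)=\sum_{m\in\mathbb Z}\exp\!\Big(\pi i\,(m+\tfrac12)^2\tau+2\pi i\,(m+\tfrac12)(z+\tfrac12)\Big),\qquad \Phi_z(x)=\frac{\theta(z+x)}{\theta(z)\,\theta(x)} .$$ Let $n\ge 1$, let $x_1,\dots,x_n,\,y_1,\dots,y_n,\,z,\,\xi\in\mathbb C$, and let $i,k\in\{1,\dots,n\}$. Write $x_{jm}=x_j-x_m$ and $y_{jm}=y_j-y_m$. Assume that none of the denominators below vanishes, that is, $\theta(z)\neq0$; $\theta(x_{jm})\ne0$ and $\theta(y_{jm})\neq 0$ for all $j\neq m$; $\theta(x_s-y_j)\neq0$ for all $s,j$; and $\theta(y_{ij}+\xi)$, $\theta(y_j-x_k+\xi)$, $\theta(y_i-x_j+\xi)$, $\theta(x_{jk}+\xi)$ are nonzero for all $j$ (all indices run over $1,\dots,n$). Then $$\sum_{j=1}^n \Phi_z(y_{ij}+\xi)\,\Phi_z(y_j-x_k+\xi)\prod_{m\ne j}\frac{\theta(y_{jm}-\xi)}{\theta(y_{jm})}\prod_{s=1}^n\frac{\theta(x_s-y_j-\xi)}{\theta(x_s-y_j)}$$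 $$=\sum_{j=1}^n \Phi_z(y_i-x_j+\xi)\,\Phi_z(x_{jk}+\xi)\prod_{m\neq j}\frac{\theta(x_{jm}+\xi)}{\theta(x_{jm})}\prod_{s=1}^n\frac{\theta(x_j-y_s-\xi)}{\theta(x_j-y_s)} .$$ -/

import Mathlib

noncomputable section

open scoped UpperHalfPlane

/-- The theta function with rational characteristics `a, b`:
`∑_{m ∈ ℤ} exp (π i (m + a)² τ + 2 π i (m + a) (z + b))`, for `τ` in the upper half-plane
(where the series converges absolutely). -/
def thetaChar (a b : ℚ) (z : ℂ) (τ : ℍ) : ℂ :=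
  ∑' m : ℤ, Complex.exp (Real.pi * Complex.I * ((m : ℂ) + (a : ℂ)) ^ 2 * (τ : ℂ)
    + 2 * Real.pi * Complex.I * ((m : ℂ) + (a : ℂ)) * (z + (b : ℂ)))

/-- The odd theta function `θ(z)`, with characteristics `1/2, 1/2`. -/
def theta (τ : ℍ) (z : ℂ) : ℂ := thetaChar (1 / 2) (1 / 2) z τ

/-- The function `Φ_z(x) = θ(z + x) / (θ(z) θ(x))`. -/
def Phi (τ : ℍ) (z x : ℂ) : ℂ := theta τ (z + x) / (theta τ z * theta τ x)

end

/-!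
The two sides are the residues of one elliptic function. Up to the common factor `θ'(0)/θ(ξ)`, the
summands of the left side are minus the residues at `w = y j`, and those of the right side the
residues at `w = x j`, of
`Φ_z(y i - w + ξ) Φ_z(w - x k + ξ) ∏_m θ(w - y m - ξ)/θ(w - y m) ∏_s θ(x s - w - ξ)/θ(x s - w)`;
the poles of the two factors `Φ_z` are cancelled by zeros of the products.

No contour integral is needed. That the residues add up to zero is the partial fraction identity
`∑_j ∏_m θ(a j - b m) / ∏_{m ≠ j} θ(a j - a m) = 0` for `∑ a = ∑ b`
(`sum_prod_theta_div_prod_theta_eq_zero`), used with `a = (y, x)` and with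
`b = (y m + ξ, x s - ξ)` modified by `+ z` at `y i` and by `- z` at `x k`.

The partial fraction identity is proved by induction on the number of points. By Weierstrass's
three-term relation (`theta_mul_theta_mul_theta_mul_theta`) the product `θ(w - b₁) θ(w - b₂)` is a
linear combination of `θ(w - a₁) θ(w - b₁ - b₂ + a₁)` and `θ(w - a₂) θ(w - b₁ - b₂ + a₂)`, as long
as `θ(a₁ + a₂ - b₁ - b₂) ≠ 0`; either term cancels a factor of the denominators and leaves an
identity with one point fewer. The exceptional case follows by continuity, the zeros of `θ` being
isolated.

The three-term relation is the Plücker relation for `2 × 2` minors, because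
`θ(x + y) θ(x - y) = E(x) O(y) - O(x) E(y)` (`theta_add_mul_theta_sub`), where `E` and `O` are the
sums over even and odd `M` of `exp(π i M² τ/2 + 2 π i M x)`.
-/

open Finset

/-! ### The series of the theta function -/

/-- The `m`-th term of the series defining `theta τ z`. -/
noncomputable def thetaTerm (τ : UpperHalfPlane) (z : ℂ) (m : ℤ) : ℂ :=
  Complex.exp (Real.pi * Complex.I * ((m : ℂ) + 1 / 2) ^ 2 * (τ : ℂ)
    + 2 * Real.pi * Complex.I * ((m : ℂ) + 1 / 2) * (z + 1 / 2))

lemma theta_eq_tsum (τ : UpperHalfPlane) (z : ℂ) : theta τ z = ∑' m : ℤ, thetaTerm τ z m := by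
  simp only [theta, thetaChar, thetaTerm]
  push_cast
  rfl

lemma thetaTerm_eq_jacobiTheta₂_term (τ : UpperHalfPlane) (z : ℂ) (m : ℤ) :
    thetaTerm τ z m = Complex.exp (Real.pi * Complex.I * ((τ : ℂ) / 4 + z + 1 / 2))
      * jacobiTheta₂_term m (z + 1 / 2 + τ / 2) τ := by
  rw [thetaTerm, jacobiTheta₂_term, ← Complex.exp_add]
  congr 1
  ring

lemma summable_thetaTerm (τ : UpperHalfPlane) (z : ℂ) : Summable (thetaTerm τ z) := by
  simp only [funext (thetaTerm_eq_jacobiTheta₂_term τ z)]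
  exact ((summable_jacobiTheta₂_term_iff _ _).2 τ.im_pos).mul_left _

lemma theta_eq_jacobiTheta₂ (τ : UpperHalfPlane) (z : ℂ) :
    theta τ z = Complex.exp (Real.pi * Complex.I * ((τ : ℂ) / 4 + z + 1 / 2))
      * jacobiTheta₂ (z + 1 / 2 + τ / 2) τ := by
  rw [theta_eq_tsum, jacobiTheta₂, ← tsum_mul_left]
  exact tsum_congr (thetaTerm_eq_jacobiTheta₂_term τ z)

lemma differentiable_theta (τ : UpperHalfPlane) : Differentiable ℂ (theta τ) := by
  rw [funext (theta_eq_jacobiTheta₂ τ)]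
  refine Differentiable.mul (by fun_prop) fun z => ?_
  exact (differentiableAt_jacobiTheta₂_fst (z + 1 / 2 + τ / 2) τ.im_pos).comp z
    (f := fun z : ℂ => z + 1 / 2 + (τ : ℂ) / 2) (by fun_prop)

lemma exp_pi_mul_I_mul_int_of_even {M : ℤ} (h : Even M) :
    Complex.exp (Real.pi * Complex.I * M) = 1 := by
  obtain ⟨k, rfl⟩ := h
  rw [← Complex.exp_int_mul_two_pi_mul_I k]
  congr 1
  push_cast
  ring

lemma exp_pi_mul_I_mul_int_of_odd {M : ℤ} (h : Odd M) :
    Complex.exp (Real.pi * Complex.I * M) = -1 := by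
  obtain ⟨k, rfl⟩ := h
  have h1 : (Real.pi * Complex.I * ((2 * k + 1 : ℤ) : ℂ) : ℂ)
      = k * (2 * Real.pi * Complex.I) + Real.pi * Complex.I := by
    push_cast
    ring
  rw [h1, Complex.exp_add, Complex.exp_int_mul_two_pi_mul_I, Complex.exp_pi_mul_I, one_mul]

lemma theta_neg (τ : UpperHalfPlane) (z : ℂ) : theta τ (-z) = -theta τ z := by
  -- The reflection `m ↦ -1 - m` of the index negates `m + 1/2`.
  rw [theta_eq_tsum, theta_eq_tsum, ← tsum_neg, ← (Equiv.subLeft (-1 : ℤ)).tsum_eq]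
  refine tsum_congr fun m => ?_
  have h : (-1 : ℂ) = Complex.exp (Real.pi * Complex.I * ((2 * (-1 - m) + 1 : ℤ) : ℂ)) :=
    (exp_pi_mul_I_mul_int_of_odd ⟨_, rfl⟩).symm
  rw [neg_eq_neg_one_mul (thetaTerm τ z m), h, thetaTerm, thetaTerm, ← Complex.exp_add]
  congr 1
  simp only [Equiv.subLeft_apply]
  push_cast
  ring

lemma theta_zero (τ : UpperHalfPlane) : theta τ 0 = 0 := by
  have h := theta_neg τ 0
  rw [neg_zero] at h
  exact self_eq_neg.1 h

lemma theta_sub_comm (τ : UpperHalfPlane) (a b : ℂ) : theta τ (a - b) = -theta τ (b - a) := by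
  rw [← theta_neg, neg_sub]

lemma dense_theta_ne_zero {τ : UpperHalfPlane} {z : ℂ} (hz : theta τ z ≠ 0) (c : ℂ) :
    Dense {t | theta τ (c - t) ≠ 0} := by
  have hd : Differentiable ℂ fun t => theta τ (c - t) :=
    (differentiable_theta τ).comp (by fun_prop)
  have ha : AnalyticOnNhd ℂ (fun t => theta τ (c - t)) Set.univ := fun t _ => hd.analyticAt t
  intro t
  by_contra ht
  rw [mem_closure_iff_frequently, Filter.not_frequently] at ht
  have h0 : (fun t => theta τ (c - t)) = 0 :=
    ha.eq_of_eventuallyEq (fun _ _ => analyticAt_const) (z₀ := t)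
      (ht.mono fun u hu => by simpa using hu)
  exact hz (by simpa using congrFun h0 (c - z))

/-! ### The three-term relation -/

/-- The terms with even index `M` of the series `∑_M exp(π i M² τ/2 + 2 π i M x)`. -/
noncomputable def evenTerm (τ : UpperHalfPlane) (x : ℂ) : ℤ → ℂ :=
  Set.indicator {M | Even M} fun M => jacobiTheta₂_term M x (τ / 2)

/-- The terms with odd index `M` of the series `∑_M exp(π i M² τ/2 + 2 π i M x)`. -/
noncomputable def oddTerm (τ : UpperHalfPlane) (x : ℂ) : ℤ → ℂ :=
  Set.indicator {M | Odd M} fun M => jacobiTheta₂_term M x (τ / 2)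

lemma summable_jacobiTheta₂_term_half (τ : UpperHalfPlane) (x : ℂ) :
    Summable fun M : ℤ => jacobiTheta₂_term M x (τ / 2) := by
  refine (summable_jacobiTheta₂_term_iff _ _).2 ?_
  have h := τ.im_pos
  have h2 : ((τ : ℂ) / 2).im = (τ : ℂ).im / 2 := by simp
  rw [h2]
  exact half_pos h

lemma summable_evenTerm (τ : UpperHalfPlane) (x : ℂ) : Summable (evenTerm τ x) :=
  (summable_jacobiTheta₂_term_half τ x).indicator _

lemma summable_oddTerm (τ : UpperHalfPlane) (x : ℂ) : Summable (oddTerm τ x) :=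
  (summable_jacobiTheta₂_term_half τ x).indicator _

lemma thetaTerm_mul_thetaTerm (τ : UpperHalfPlane) (x y : ℂ) (m n : ℤ) :
    thetaTerm τ (x + y) m * thetaTerm τ (x - y) n
      = Complex.exp (Real.pi * Complex.I * ((m + n + 1 : ℤ) : ℂ))
        * (jacobiTheta₂_term (m + n + 1) x (τ / 2) * jacobiTheta₂_term (m - n) y (τ / 2)) := by
  simp only [thetaTerm, jacobiTheta₂_term, ← Complex.exp_add]
  congr 1
  push_cast
  ring

/-- Multiply the two series and sum over `M = m + n + 1` and `D = m - n`, which run over all pairs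
of integers of opposite parity. -/
lemma theta_add_mul_theta_sub (τ : UpperHalfPlane) (x y : ℂ) :
    theta τ (x + y) * theta τ (x - y)
      = (∑' M, evenTerm τ x M) * (∑' D, oddTerm τ y D)
        - (∑' M, oddTerm τ x M) * (∑' D, evenTerm τ y D) := by
  have hEx := (summable_evenTerm τ x).norm
  have hEy := (summable_evenTerm τ y).norm
  have hOx := (summable_oddTerm τ x).norm
  have hOy := (summable_oddTerm τ y).norm
  rw [theta_eq_tsum, theta_eq_tsum,
    tsum_mul_tsum_of_summable_norm (summable_thetaTerm τ _).norm (summable_thetaTerm τ _).norm,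
    tsum_mul_tsum_of_summable_norm hEx hOy, tsum_mul_tsum_of_summable_norm hOx hEy,
    ← (summable_mul_of_summable_norm hEx hOy).tsum_sub (summable_mul_of_summable_norm hOx hEy)]
  have he : Function.Injective fun p : ℤ × ℤ => (p.1 + p.2 + 1, p.1 - p.2) := by
    rintro ⟨a, b⟩ ⟨c, d⟩ h
    simp only [Prod.mk.injEq] at h ⊢
    omega
  rw [← he.tsum_eq (f := fun p : ℤ × ℤ =>
    evenTerm τ x p.1 * oddTerm τ y p.2 - oddTerm τ x p.1 * evenTerm τ y p.2)]
  · refine tsum_congr fun ⟨m, n⟩ => ?_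
    simp only [thetaTerm_mul_thetaTerm, evenTerm, oddTerm]
    rcases Int.even_or_odd (m + n + 1) with h | h
    · have h1 : Odd (m - n) := by grind
      have h2 : ¬ Odd (m + n + 1) := by grind
      rw [exp_pi_mul_I_mul_int_of_even h]
      simp [-Int.not_odd_iff_even, h, h1, h2]
    · have h1 : Even (m - n) := by grind
      have h2 : ¬ Even (m + n + 1) := by grind
      rw [exp_pi_mul_I_mul_int_of_odd h]
      simp [-Int.not_even_iff_odd, h, h1, h2]
  · rintro ⟨M, D⟩ h
    simp only [Function.mem_support, evenTerm, oddTerm, Set.indicator_apply, Set.mem_ofPred_eq] at h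
    have hMD : ∃ k, M - 1 + D = 2 * k := by
      by_contra hk
      apply h
      rcases Int.even_or_odd' M with ⟨u, rfl | rfl⟩ <;> rcases Int.even_or_odd' D with ⟨v, rfl | rfl⟩
      · simp [Int.odd_iff]
      · exact (hk ⟨u + v, by ring⟩).elim
      · exact (hk ⟨u + v, by ring⟩).elim
      · simp [Int.odd_iff]
    obtain ⟨k, hk⟩ := hMD
    exact ⟨(k, k - D), by simp only [Prod.mk.injEq]; omega⟩

/-- Weierstrass's three-term relation, as a linear relation between the products
`θ(w - u) θ(w - (b₁ + b₂ - u))` for `u = b₁, a₁, a₂`. -/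
lemma theta_mul_theta_mul_theta_mul_theta (τ : UpperHalfPlane) (w a₁ a₂ b₁ b₂ : ℂ) :
    theta τ (a₁ + a₂ - b₁ - b₂) * theta τ (a₁ - a₂) * (theta τ (w - b₁) * theta τ (w - b₂))
      = theta τ (a₁ - b₁) * theta τ (a₁ - b₂) * (theta τ (w - a₂) * theta τ (w - (b₁ + b₂ - a₂)))
        - theta τ (a₂ - b₁) * theta τ (a₂ - b₂)
          * (theta τ (w - a₁) * theta τ (w - (b₁ + b₂ - a₁))) := by
  -- Measured from the midpoint of `b₁` and `b₂`, each product has the form `θ(u + v) θ(u - v)`.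
  have key (u v : ℂ) : theta τ (u + v - b₁ - b₂) * theta τ (u - v)
      = theta τ ((u - (b₁ + b₂) / 2) + (v - (b₁ + b₂) / 2))
        * theta τ ((u - (b₁ + b₂) / 2) - (v - (b₁ + b₂) / 2)) := by
    congr 2 <;> ring
  have h1 (u : ℂ) : theta τ (u - b₁) * theta τ (u - b₂)
      = theta τ (u + b₁ - b₁ - b₂) * theta τ (u - b₁) := by
    rw [mul_comm]
    congr 2
    ring
  have h2 (u : ℂ) : theta τ (w - u) * theta τ (w - (b₁ + b₂ - u))
      = theta τ (w + u - b₁ - b₂) * theta τ (w - u) := by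
    rw [mul_comm]
    congr 2
    ring
  simp only [h1, h2, key, theta_add_mul_theta_sub]
  ring

/-! ### The partial fraction identity -/

/-- The sum over `j ∈ s` of `∏_{b ∈ B} θ(a j - b) / ∏_{m ∈ s, m ≠ j} θ(a j - a m)`. -/
noncomputable def thetaPartialFractionSum {ι : Type*} [DecidableEq ι] (τ : UpperHalfPlane) (a : ι → ℂ)
    (s : Finset ι) (B : Multiset ℂ) : ℂ :=
  ∑ j ∈ s, (B.map fun b => theta τ (a j - b)).prod / ∏ m ∈ s.erase j, theta τ (a j - a m)

/-- A factor `θ(w - a c)` of the numerator removes the point `a c`. -/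
lemma thetaPartialFractionSum_cons_self {ι : Type*} [DecidableEq ι] {τ : UpperHalfPlane}
    {a : ι → ℂ} {s : Finset ι} (ha : ∀ j ∈ s, ∀ m ∈ s, m ≠ j → theta τ (a j - a m) ≠ 0)
    {c : ι} (hc : c ∈ s) (B : Multiset ℂ) :
    thetaPartialFractionSum τ a s (a c ::ₘ B) = thetaPartialFractionSum τ a (s.erase c) B := by
  rw [thetaPartialFractionSum, ← add_sum_erase _ _ hc, thetaPartialFractionSum]
  simp only [Multiset.map_cons, Multiset.prod_cons, sub_self, theta_zero, zero_mul, zero_div,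
    zero_add]
  refine sum_congr rfl fun j hj => ?_
  obtain ⟨hjc, hjs⟩ := mem_erase.1 hj
  rw [← mul_prod_erase (s.erase j) _ (mem_erase.2 ⟨hjc.symm, hc⟩), erase_right_comm,
    mul_div_mul_left _ _ (ha j hjs c hc hjc.symm)]

lemma thetaPartialFractionSum_three_term {ι : Type*} [DecidableEq ι] (τ : UpperHalfPlane)
    (a : ι → ℂ) (s : Finset ι) (a₁ a₂ b₁ b₂ : ℂ) (B : Multiset ℂ) :
    theta τ (a₁ + a₂ - b₁ - b₂) * theta τ (a₁ - a₂)
        * thetaPartialFractionSum τ a s (b₁ ::ₘ b₂ ::ₘ B)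
      = theta τ (a₁ - b₁) * theta τ (a₁ - b₂)
          * thetaPartialFractionSum τ a s (a₂ ::ₘ (b₁ + b₂ - a₂) ::ₘ B)
        - theta τ (a₂ - b₁) * theta τ (a₂ - b₂)
          * thetaPartialFractionSum τ a s (a₁ ::ₘ (b₁ + b₂ - a₁) ::ₘ B) := by
  simp only [thetaPartialFractionSum, mul_sum, ← sum_sub_distrib, Multiset.map_cons,
    Multiset.prod_cons, mul_div_assoc']
  refine sum_congr rfl fun j _ => ?_
  rw [← sub_div]
  congr 1
  linear_combination (B.map fun b => theta τ (a j - b)).prod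
    * theta_mul_theta_mul_theta_mul_theta τ (a j) a₁ a₂ b₁ b₂

lemma continuous_thetaPartialFractionSum {ι : Type*} [DecidableEq ι] (τ : UpperHalfPlane)
    (a : ι → ℂ) (s : Finset ι) (b₁ b₂ b₃ : ℂ) (B : Multiset ℂ) :
    Continuous fun t =>
      thetaPartialFractionSum τ a s ((b₁ + t) ::ₘ b₂ ::ₘ (b₃ - t) ::ₘ B) := by
  have h := (differentiable_theta τ).continuous
  simp only [thetaPartialFractionSum, Multiset.map_cons, Multiset.prod_cons]
  fun_prop

lemma thetaPartialFractionSum_eq_zero {ι : Type*} [DecidableEq ι] {τ : UpperHalfPlane} {z : ℂ}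
    (hz : theta τ z ≠ 0) (a : ι → ℂ) (N : ℕ) (s : Finset ι) (B : Multiset ℂ)
    (ha : ∀ j ∈ s, ∀ m ∈ s, m ≠ j → theta τ (a j - a m) ≠ 0)
    (hs : s.card = N) (hB : B.card = N) (hsum : B.sum = ∑ j ∈ s, a j) :
    thetaPartialFractionSum τ a s B = 0 := by
  induction N generalizing s B with
  | zero => simp [thetaPartialFractionSum, card_eq_zero.1 hs]
  | succ N ih =>
    match N, ih with
    | 0, _ =>
      obtain ⟨c, rfl⟩ := card_eq_one.1 hs
      obtain ⟨b, rfl⟩ := Multiset.card_eq_one.1 hB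
      have hb : b = a c := by simpa using hsum
      simp [thetaPartialFractionSum, hb, theta_zero]
    | 1, _ =>
      -- Here `θ(a₁ + a₂ - b₁ - b₂) = θ(0) = 0`, so the three-term relation gives nothing; the two
      -- summands cancel because `θ` is odd.
      obtain ⟨c, d, hcd, rfl⟩ := card_eq_two.1 hs
      obtain ⟨b₁, b₂, rfl⟩ := Multiset.card_eq_two.1 hB
      have hb : b₁ = a c + a d - b₂ := by
        rw [sum_pair hcd] at hsum
        simp at hsum
        linear_combination hsum
      have h1 : a c - (a c + a d - b₂) = b₂ - a d := by ring
      have h2 : a d - (a c + a d - b₂) = b₂ - a c := by ring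
      have h3 : ({c, d} : Finset ι).erase c = {d} := by grind
      have h4 : ({c, d} : Finset ι).erase d = {c} := by grind
      simp only [thetaPartialFractionSum, sum_pair hcd, hb, h3, h4, prod_singleton,
        Multiset.insert_eq_cons, Multiset.map_cons, Multiset.map_singleton, Multiset.prod_cons,
        Multiset.prod_singleton, h1, h2]
      rw [theta_sub_comm τ b₂ (a d), theta_sub_comm τ b₂ (a c), theta_sub_comm τ (a d) (a c)]
      ring
    | N + 2, ih =>
      obtain ⟨b₁, B₁, rfl⟩ := Multiset.card_pos_iff_exists_mem.1 (by omega : 0 < B.card)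
        |>.imp fun b hb => Multiset.exists_cons_of_mem hb
      simp only [Multiset.card_cons, add_left_inj] at hB
      obtain ⟨b₂, B₂, rfl⟩ := Multiset.card_pos_iff_exists_mem.1 (by omega : 0 < B₁.card)
        |>.imp fun b hb => Multiset.exists_cons_of_mem hb
      simp only [Multiset.card_cons, add_left_inj] at hB
      obtain ⟨b₃, B, rfl⟩ := Multiset.card_pos_iff_exists_mem.1 (by omega : 0 < B₂.card)
        |>.imp fun b hb => Multiset.exists_cons_of_mem hb
      simp only [Multiset.card_cons] at hB
      simp only [Multiset.sum_cons] at hsum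
      obtain ⟨c, hc, d, hd, hcd⟩ := one_lt_card.1 (by omega : 1 < s.card)
      -- When a zero of the numerators is one of the points, the induction hypothesis applies.
      have herase (e : ι) (he : e ∈ s) (C : Multiset ℂ) (hC : C.card = N + 2)
          (hCsum : a e + C.sum = ∑ j ∈ s, a j) :
          thetaPartialFractionSum τ a s (a e ::ₘ C) = 0 := by
        rw [thetaPartialFractionSum_cons_self ha he]
        refine ih _ _ (fun j hj m hm => ha j (mem_of_mem_erase hj) m (mem_of_mem_erase hm)) ?_ hC ?_
        · rw [card_erase_of_mem he]
          omega
        · rw [← add_sum_erase _ _ he] at hCsum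
          exact add_left_cancel hCsum
      -- Moving `b₁` to `b₁ + t` and `b₃` to `b₃ - t` keeps the sum and makes the coefficient
      -- `θ(a₁ + a₂ - b₁ - b₂)` nonzero for a dense set of `t`.
      have hzero : (fun t =>
          thetaPartialFractionSum τ a s ((b₁ + t) ::ₘ b₂ ::ₘ (b₃ - t) ::ₘ B)) = fun _ => 0 := by
        refine (continuous_thetaPartialFractionSum τ a s b₁ b₂ b₃ B).ext_on
          (dense_theta_ne_zero hz (a c + a d - b₁ - b₂)) continuous_const fun t ht => ?_
        have h3 := thetaPartialFractionSum_three_term τ a s (a c) (a d) (b₁ + t) b₂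
          ((b₃ - t) ::ₘ B)
        rw [herase d hd _ (by simpa using hB)
            (by simp only [Multiset.sum_cons]; linear_combination hsum),
          herase c hc _ (by simpa using hB)
            (by simp only [Multiset.sum_cons]; linear_combination hsum),
          mul_zero, mul_zero, sub_zero] at h3
        have ht' : theta τ (a c + a d - (b₁ + t) - b₂) ≠ 0 := by
          have harg : a c + a d - (b₁ + t) - b₂ = a c + a d - b₁ - b₂ - t := by ring
          rw [harg]
          exact ht
        exact (mul_eq_zero.1 h3).resolve_left (mul_ne_zero ht' (ha c hc d hd hcd.symm))
      simpa using congrFun hzero 0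

theorem sum_prod_theta_div_prod_theta_eq_zero {ι : Type*} [Fintype ι] [DecidableEq ι]
    {τ : UpperHalfPlane} {z : ℂ} (hz : theta τ z ≠ 0) (a b : ι → ℂ)
    (ha : ∀ j m, m ≠ j → theta τ (a j - a m) ≠ 0) (hab : ∑ j, b j = ∑ j, a j) :
    ∑ j, (∏ m, theta τ (a j - b m)) / ∏ m ∈ univ.erase j, theta τ (a j - a m) = 0 := by
  have h := thetaPartialFractionSum_eq_zero hz a (Fintype.card ι) univ (univ.val.map b)
    (fun j _ m _ => ha j m) rfl (by simp) (by simpa using hab)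
  simp only [thetaPartialFractionSum, Multiset.map_map] at h
  exact h

/-! ### The residues -/

/-- Replacing one zero `c i` of a product of theta functions by `c i + z`. -/
lemma prod_theta_sub_add_ite {ι : Type*} [Fintype ι] [DecidableEq ι] (τ : UpperHalfPlane)
    (c : ι → ℂ) (i : ι) (z w : ℂ) (h : theta τ (w - c i) ≠ 0) :
    ∏ m, theta τ (w - (c m + if m = i then z else 0))
      = theta τ (w - c i - z) / theta τ (w - c i) * ∏ m, theta τ (w - c m) := by
  rw [← mul_prod_erase univ _ (mem_univ i), ← mul_prod_erase univ _ (mem_univ i), ← mul_assoc,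
    div_mul_cancel₀ _ h, if_pos rfl, sub_sub]
  congr 1
  refine prod_congr rfl fun m hm => ?_
  rw [if_neg (ne_of_mem_erase hm), add_zero]

lemma prod_theta_div_theta_neg {ι : Type*} (τ : UpperHalfPlane) (s : Finset ι) (f g : ι → ℂ) :
    ∏ m ∈ s, theta τ (-f m) / theta τ (-g m) = ∏ m ∈ s, theta τ (f m) / theta τ (g m) := by
  simp only [theta_neg, neg_div_neg_eq]

lemma erase_inl_univ {ι κ : Type*} [Fintype ι] [Fintype κ] [DecidableEq ι] [DecidableEq κ]
    (j : ι) : (univ : Finset (ι ⊕ κ)).erase (Sum.inl j) = (univ.erase j).disjSum univ := by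
  ext (a | a) <;> simp

lemma erase_inr_univ {ι κ : Type*} [Fintype ι] [Fintype κ] [DecidableEq ι] [DecidableEq κ]
    (j : κ) : (univ : Finset (ι ⊕ κ)).erase (Sum.inr j) = univ.disjSum (univ.erase j) := by
  ext (a | a) <;> simp

theorem mainTheorem1 (τ : UpperHalfPlane) (n : ℕ) (x y : Fin n → ℂ) (z ξ : ℂ) (i k : Fin n)
    (hz : theta τ z ≠ 0)
    (hy : ∀ j m, m ≠ j → theta τ (y j - y m) ≠ 0)
    (hx : ∀ j m, m ≠ j → theta τ (x j - x m) ≠ 0)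
    (hxy : ∀ s j, theta τ (x s - y j) ≠ 0)
    (hyξ : ∀ j, theta τ (y i - y j + ξ) ≠ 0 ∧ theta τ (y j - x k + ξ) ≠ 0)
    (hxξ : ∀ j, theta τ (y i - x j + ξ) ≠ 0 ∧ theta τ (x j - x k + ξ) ≠ 0) :
    ∑ j, Phi τ z (y i - y j + ξ) * Phi τ z (y j - x k + ξ)
        * (∏ m ∈ Finset.univ.erase j, theta τ (y j - y m - ξ) / theta τ (y j - y m))
        * (∏ s, theta τ (x s - y j - ξ) / theta τ (x s - y j))
      = ∑ j, Phi τ z (y i - x j + ξ) * Phi τ z (x j - x k + ξ)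
        * (∏ m ∈ Finset.univ.erase j, theta τ (x j - x m + ξ) / theta τ (x j - x m))
        * (∏ s, theta τ (x j - y s - ξ) / theta τ (x j - y s)) := by
  have hξ : theta τ ξ ≠ 0 := by simpa using (hyξ i).1
  have hyx (j s) : theta τ (y j - x s) ≠ 0 := by
    rw [theta_sub_comm]
    exact neg_ne_zero.2 (hxy s j)
  have hpf := sum_prod_theta_div_prod_theta_eq_zero hz (Sum.elim y x)
    (Sum.elim (fun m => y m + ξ + if m = i then z else 0)
      (fun s => x s - ξ + if s = k then -z else 0))
    (by
      rintro (j | j) (m | m) h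
      · exact hy j m fun e => h (by rw [e])
      · exact hyx j m
      · exact hxy j m
      · exact hx j m fun e => h (by rw [e]))
    (by
      simp [sum_add_distrib, Finset.sum_sub_distrib]
      ring)
  simp only [Fintype.sum_sum_type, Fintype.prod_sum_type, Sum.elim_inl, Sum.elim_inr,
    erase_inl_univ, erase_inr_univ, prod_disjSum] at hpf
  -- The summands at the points `y j` and `x j` are those of the two sides, up to the factors
  -- `-θ(ξ) θ(z)²` and `θ(ξ) θ(z)²`; the sign comes from the factor `θ(y j - y j - ξ)`.
  have hL (j : Fin n) :
      (∏ m, theta τ (y j - (y m + ξ + if m = i then z else 0)))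
          * (∏ s, theta τ (y j - (x s - ξ + if s = k then -z else 0)))
        / ((∏ m ∈ univ.erase j, theta τ (y j - y m)) * ∏ s, theta τ (y j - x s))
      = -(theta τ ξ * theta τ z ^ 2) * (Phi τ z (y i - y j + ξ) * Phi τ z (y j - x k + ξ)
        * (∏ m ∈ univ.erase j, theta τ (y j - y m - ξ) / theta τ (y j - y m))
        * (∏ s, theta τ (x s - y j - ξ) / theta τ (x s - y j))) := by
    have h1 : theta τ (y j - (y i + ξ)) = -theta τ (y i - y j + ξ) := by
      rw [← theta_neg]; congr 1; ring
    have h2 : theta τ (y j - (y i + ξ) - z) = -theta τ (z + (y i - y j + ξ)) := by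
      rw [← theta_neg]; congr 1; ring
    have h3 : y j - (x k - ξ) = y j - x k + ξ := by ring
    have h4 : y j - x k + ξ - -z = z + (y j - x k + ξ) := by ring
    have h5 : ∏ m, theta τ (y j - (y m + ξ))
        = -theta τ ξ * ∏ m ∈ univ.erase j, theta τ (y j - y m - ξ) := by
      rw [← mul_prod_erase univ _ (mem_univ j), ← theta_neg]
      simp only [sub_add_cancel_left, sub_sub]
    have h6 : ∏ s, theta τ (x s - y j - ξ) / theta τ (x s - y j)
        = (∏ s, theta τ (y j - (x s - ξ))) / ∏ s, theta τ (y j - x s) := by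
      rw [← prod_theta_div_theta_neg, ← prod_div_distrib]
      refine prod_congr rfl fun s _ => ?_
      congr 2 <;> ring
    have ha := (hyξ j).1
    have hb := (hyξ j).2
    rw [prod_theta_sub_add_ite τ (fun m => y m + ξ) i z (y j) (by rw [h1]; exact neg_ne_zero.2 ha),
      prod_theta_sub_add_ite τ (fun s => x s - ξ) k (-z) (y j) (by rw [h3]; exact hb),
      h1, h2, h3, h4, h5, h6, prod_div_distrib, Phi, Phi, neg_div_neg_eq]
    have hd1 : ∏ m ∈ univ.erase j, theta τ (y j - y m) ≠ 0 :=
      prod_ne_zero_iff.2 fun m hm => hy j m (ne_of_mem_erase hm)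
    have hd2 : ∏ s, theta τ (y j - x s) ≠ 0 := prod_ne_zero_iff.2 fun s _ => hyx j s
    field_simp
  have hR (j : Fin n) :
      (∏ m, theta τ (x j - (y m + ξ + if m = i then z else 0)))
          * (∏ s, theta τ (x j - (x s - ξ + if s = k then -z else 0)))
        / ((∏ m, theta τ (x j - y m)) * ∏ s ∈ univ.erase j, theta τ (x j - x s))
      = theta τ ξ * theta τ z ^ 2 * (Phi τ z (y i - x j + ξ) * Phi τ z (x j - x k + ξ)
        * (∏ m ∈ univ.erase j, theta τ (x j - x m + ξ) / theta τ (x j - x m))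
        * (∏ s, theta τ (x j - y s - ξ) / theta τ (x j - y s))) := by
    have h1 : theta τ (x j - (y i + ξ)) = -theta τ (y i - x j + ξ) := by
      rw [← theta_neg]; congr 1; ring
    have h2 : theta τ (x j - (y i + ξ) - z) = -theta τ (z + (y i - x j + ξ)) := by
      rw [← theta_neg]; congr 1; ring
    have h3 : x j - (x k - ξ) = x j - x k + ξ := by ring
    have h4 : x j - x k + ξ - -z = z + (x j - x k + ξ) := by ring
    have h5 : ∏ s, theta τ (x j - (x s - ξ))
        = theta τ ξ * ∏ m ∈ univ.erase j, theta τ (x j - x m + ξ) := by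
      rw [← mul_prod_erase univ _ (mem_univ j)]
      simp only [sub_sub_cancel, sub_sub_eq_add_sub, sub_add_eq_add_sub]
    have ha := (hxξ j).1
    have hb := (hxξ j).2
    rw [prod_theta_sub_add_ite τ (fun m => y m + ξ) i z (x j) (by rw [h1]; exact neg_ne_zero.2 ha),
      prod_theta_sub_add_ite τ (fun s => x s - ξ) k (-z) (x j) (by rw [h3]; exact hb),
      h1, h2, h3, h4, h5, prod_div_distrib, prod_div_distrib, Phi, Phi, neg_div_neg_eq]
    have hd1 : ∏ m ∈ univ.erase j, theta τ (x j - x m) ≠ 0 :=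
      prod_ne_zero_iff.2 fun m hm => hx j m (ne_of_mem_erase hm)
    have hd2 : ∏ s, theta τ (x j - y s) ≠ 0 := prod_ne_zero_iff.2 fun s _ => hxy j s
    simp only [← sub_sub]
    field_simp
  simp only [hL, hR, ← mul_sum] at hpf
  refine mul_left_cancel₀ (mul_ne_zero hξ (pow_ne_zero 2 hz)) ?_
  linear_combination -hpf
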